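/- A welfare rule is a function $w:\{1,2,\dots\}\to\mathbb{R}_{>0}$, extended by $w(0)=0$. It is submodular if $w(j+1)\ge w(j)$ for all $j\ge 0$ and $w(j+1)-w(j)$ is non-increasing in $j\ge 0$; a submodular welfare rule has curvature $c'\in[0,1]$ if $c'=1-\lim_{n\to\infty}(w(n+1)-w(n))/w(1)$. A resource allocation game $G$ consists of agents $1,\dots,n$, a finite set $R$ of resources, for each agent $i$ a finite set $A_i\subseteq 2^R$ of actions with $\varnothing\in A_i$, and for each resource $r$ a welfare rule $w_r$ and a utility rule $f_r:\{1,2,\dots\}\to\mathbb{R}_{\ge 0}$. For a joint action $a\in A=A_1\times\cdots\times A_n$ let $|a|_r$ be the number of agents $i$ with $r\in a_i$. The welfare of $a$ is $W(a)=\sum_{r\in\bigcup_i a_i}w_r(|a|_r)$ and the utility of agent $i$ is $U_i(a)=\sum_{r\in a_i}f_r(|a|_r)$. In a one-round best-response walk all agents start at the action $\varnothing$, and the agents $1,2,\dots,n$ then move once each, in this order; the moving agent switches to an arbitrary action that maximizes its utility given the current actions of the others. Let $\mathrm{sol}(1)\subseteq A$ be the set of joint actions in which such a walk can end, and for games with $\max_{a\in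 A}W(a)>0$ put $$\mathrm{Eff}(G;1)=\frac{\min_{a\in\mathrm{sol}(1)}W(a)}{\max_{a\in A}W(a)}.$$ For a set $\mathcal{W}$ of welfare rules and a utility design $F:\mathcal{W}\to\mathbb{R}_{\ge 0}^{\mathbb{N}}$ let $\mathcal{G}_{\mathcal{W},F}$ be the set of all such games (with any number of agents and resources) in which $w_r\in\mathcal{W}$ and $f_r=F(w_r)$ for every resource $r$, and let $$\mathrm{Eff}^*(\mathcal{W};1)=\sup_{F}\ \inf_{G\in\mathcal{G}_{\mathcal{W},F}}\mathrm{Eff}(G;1)$$ be the optimal efficiency guarantee achievable with a one-round best-response walk. **Theorem.** Let $c\in[0,1]$ and let $\mathcal{W}$ be the set of all submodular welfare rules of curvature at most $c$. Then $$\mathrm{Eff}^*(\mathcal{W};1)=1-\frac{c}{2}\ \Big(\ge\frac12\Big).$$ -/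

import Mathlib

open scoped NNReal

namespace ResourceAllocation

/-- A welfare rule is given by its values `w j > 0` at the numbers `j ≥ 1` of users of a resource;
an unused resource contributes nothing, `w 0 = 0`. -/
def IsWelfareRule (w : ℕ → ℝ) : Prop :=
  w 0 = 0 ∧ ∀ j, 1 ≤ j → 0 < w j

/-- Submodularity: `w` is nondecreasing and its increments are nonincreasing
(including the first increment `w 1 - w 0`). -/
def IsSubmodular (w : ℕ → ℝ) : Prop :=
  (∀ j, w j ≤ w (j + 1)) ∧ ∀ j, w (j + 2) - w (j + 1) ≤ w (j + 1) - w j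

/-- The submodular welfare rule `w` has curvature `c ∈ [0, 1]`, where
`c = 1 - lim (w (n + 1) - w n) / w 1`. -/
def HasCurvature (w : ℕ → ℝ) (c : ℝ) : Prop :=
  IsWelfareRule w ∧ IsSubmodular w ∧ c ∈ Set.Icc (0 : ℝ) 1 ∧
    Filter.Tendsto (fun n : ℕ => 1 - (w (n + 1) - w n) / w 1) Filter.atTop (nhds c)

/-- The set of all welfare rules of curvature at most `c`. -/
def curvatureClass (c : ℝ) : Set (ℕ → ℝ) :=
  {w | ∃ c' : ℝ, c' ≤ c ∧ HasCurvature w c'}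

/-- A resource allocation game with agents `0, …, n - 1` and resources `0, …, m - 1`. Each agent has
a finite set of actions, which are sets of resources and include the null action `∅`. Each
resource `r` carries a welfare rule `w r` and a nonnegative utility rule `f r`; only the values
`w r j` and `f r j` with `j ≥ 1` enter. -/
structure Game where
  n : ℕ
  m : ℕ
  act : Fin n → Finset (Finset (Fin m))
  null_mem : ∀ i, ∅ ∈ act i
  w : Fin m → ℕ → ℝ
  f : Fin m → ℕ → ℝ≥0

namespace Game

/-- An assignment of a set of resources to each agent. -/
abbrev Profile (G : Game) : Type := Fin G.n → Finset (Fin G.m)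

/-- The joint actions. -/
def jointActions (G : Game) : Set G.Profile :=
  {a | ∀ i, a i ∈ G.act i}

/-- The number of agents that select the resource `r` in `a`. -/
def load (G : Game) (a : G.Profile) (r : Fin G.m) : ℕ :=
  (Finset.univ.filter fun i => r ∈ a i).card

/-- The system welfare, a sum over the resources selected by at least one agent. -/
noncomputable def welfare (G : Game) (a : G.Profile) : ℝ :=
  ∑ r ∈ Finset.univ.biUnion a, G.w r (G.load a r)

/-- The utility of agent `i`. -/
noncomputable def utility (G : Game) (i : Fin G.n) (a : G.Profile) : ℝ :=
  ∑ r ∈ a i, (G.f r (G.load a r) : ℝ)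

/-- The best responses of agent `i` to the actions of the other agents in `a`. -/
def bestResponses (G : Game) (a : G.Profile) (i : Fin G.n) : Set (Finset (Fin G.m)) :=
  {b | b ∈ G.act i ∧ ∀ b' ∈ G.act i,
    G.utility i (Function.update a i b') ≤ G.utility i (Function.update a i b)}

/-- `a 0, …, a T` is a trajectory of the round-robin best response process that starts with the null
joint action: at step `τ` the agent `τ mod n` plays some best response and nobody else moves. -/
def IsTrajectory (G : Game) (T : ℕ) (a : ℕ → G.Profile) : Prop :=
  (a 0 = fun _ => ∅) ∧
    ∀ τ < T, ∃ i : Fin G.n, (i : ℕ) = τ % G.n ∧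
      a (τ + 1) i ∈ G.bestResponses (a τ) i ∧ ∀ j, j ≠ i → a (τ + 1) j = a τ j

/-- The joint actions in which a `k`-round walk (`k * n` steps) can end. -/
def solutions (G : Game) (k : ℕ) : Set G.Profile :=
  {b | ∃ a : ℕ → G.Profile, G.IsTrajectory (k * G.n) a ∧ a (k * G.n) = b}

/-- The worst welfare after a `k`-round walk divided by the best welfare. Both sets of profiles
are finite and nonempty, so that infimum and supremum are a minimum and a maximum. -/
noncomputable def efficiency (G : Game) (k : ℕ) : ℝ :=
  sInf (G.welfare '' G.solutions k) / sSup (G.welfare '' G.jointActions)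

end Game

/-- A utility design for a set of welfare rules assigns a utility rule to each of its elements. -/
abbrev UtilityDesign (W : Set (ℕ → ℝ)) : Type := W → ℕ → ℝ≥0

/-- The games induced by the set `W` of welfare rules and the utility design `F`. Games in which
every joint action has welfare zero, for which the efficiency ratio is `0 / 0`, are left out. -/
def inducedGames (W : Set (ℕ → ℝ)) (F : UtilityDesign W) : Set Game :=
  {G | (∀ r, ∃ h : G.w r ∈ W, G.f r = F ⟨G.w r, h⟩) ∧ ∃ a ∈ G.jointActions, 0 < G.welfare a}

/-- The efficiency guarantee of a set of games after a `k`-round walk. The infimum is taken in the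
extended reals. -/
noncomputable def setEfficiency (S : Set Game) (k : ℕ) : EReal :=
  ⨅ G ∈ S, ((G.efficiency k : ℝ) : EReal)

/-- The optimal efficiency guarantee after a `k`-round walk, over all utility designs. -/
noncomputable def optimalEfficiency (W : Set (ℕ → ℝ)) (k : ℕ) : EReal :=
  ⨆ F : UtilityDesign W, setEfficiency (inducedGames W F) k

end ResourceAllocation

/-!
*Lower bound.* Pay every user of a resource the average of the marginal welfare and of its smallest
possible value `(1 - c) * w 1`. In a one-round walk an agent compares actions by the utility rule at
one plus the load left by its predecessors. So the utilities collected during the walk telescope,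
resource by resource, to `∑ j < x, f (j + 1)` at the final load `x`, while a deviation to the action
in an optimal profile earns at least `f (x + 1)` on each of its resources. The guarantee is thereby
reduced to a smoothness inequality for each single welfare rule, which holds because a concave
sequence lies below its tangents.

*Upper bound.* Two agents and two resources suffice. The first agent may use either resource and is
indifferent whatever the utility rule; the second may only use the first resource. If the first
agent picks the resource of the second one, the welfare is `w 2` instead of `2 * w 1`. The rule with
`w 1 = 1` and all later increments `1 - c` turns this ratio into `1 - c / 2`.
-/

namespace ResourceAllocation

open Finset Function

section WelfareRule

variable {w : ℕ → ℝ} {c : ℝ}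

theorem IsSubmodular.antitone_increment (h : IsSubmodular w) :
    Antitone fun n => w (n + 1) - w n :=
  antitone_nat_of_succ_le h.2

theorem HasCurvature.mul_le_increment (h : HasCurvature w c) (n : ℕ) :
    (1 - c) * w 1 ≤ w (n + 1) - w n := by
  obtain ⟨hw, hs, -, hlim⟩ := h
  have hw1 : 0 < w 1 := hw.2 1 le_rfl
  have hmono : Monotone fun n : ℕ => 1 - (w (n + 1) - w n) / w 1 := fun a b hab =>
    sub_le_sub_left (div_le_div_of_nonneg_right (hs.antitone_increment hab) hw1.le) 1
  rw [← le_div_iff₀ hw1]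
  exact sub_le_comm.1 (hmono.ge_of_tendsto hlim n)

theorem mul_le_increment_of_mem_curvatureClass (h : w ∈ curvatureClass c) (n : ℕ) :
    (1 - c) * w 1 ≤ w (n + 1) - w n := by
  obtain ⟨c', hc', hw⟩ := h
  have hw1 : 0 < w 1 := hw.1.2 1 le_rfl
  calc (1 - c) * w 1 ≤ (1 - c') * w 1 := by gcongr
    _ ≤ w (n + 1) - w n := hw.mul_le_increment n

theorem sub_le_mul_increment_of_antitone (h : Antitone fun n => w (n + 1) - w n) (x y : ℕ) :
    w y - w x ≤ ((y : ℝ) - x) * (w (x + 1) - w x) := by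
  rcases le_total x y with hxy | hyx
  · calc w y - w x = ∑ j ∈ Ico x y, (w (j + 1) - w j) := (sum_Ico_sub w hxy).symm
      _ ≤ #(Ico x y) • (w (x + 1) - w x) :=
        sum_le_card_nsmul _ _ _ fun j hj => h (mem_Ico.1 hj).1
      _ = ((y : ℝ) - x) * (w (x + 1) - w x) := by
        rw [Nat.card_Ico, nsmul_eq_mul, Nat.cast_sub hxy]
  · have hle : ((x : ℝ) - y) * (w (x + 1) - w x) ≤ w x - w y :=
      calc ((x : ℝ) - y) * (w (x + 1) - w x) = #(Ico y x) • (w (x + 1) - w x) := by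
            rw [Nat.card_Ico, nsmul_eq_mul, Nat.cast_sub hyx]
        _ ≤ ∑ j ∈ Ico y x, (w (j + 1) - w j) :=
          card_nsmul_le_sum _ _ _ fun j hj => h (mem_Ico.1 hj).2.le
        _ = w x - w y := sum_Ico_sub w hyx
    linarith

/-- The utility rule that pays the average of the marginal welfare and of the smallest increment
`(1 - c) * w 1` that curvature at most `c` allows. It is meant for `j ≥ 1`; on
`curvatureClass c` with `c ≤ 1` the truncation at zero has no effect there. -/
noncomputable def averagedMarginal (c : ℝ) (w : ℕ → ℝ) (j : ℕ) : ℝ≥0 :=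
  ((w j - w (j - 1) + (1 - c) * w 1) / 2).toNNReal

theorem antitone_averagedMarginal_succ (h : Antitone fun n => w (n + 1) - w n) :
    Antitone fun j => averagedMarginal c w (j + 1) := fun i j hij => by
  have hinc := h hij
  simp only [averagedMarginal, Nat.add_sub_cancel] at hinc ⊢
  gcongr

theorem coe_averagedMarginal_succ (hc : c ≤ 1) (h : w ∈ curvatureClass c) (j : ℕ) :
    (averagedMarginal c w (j + 1) : ℝ) = (w (j + 1) - w j + (1 - c) * w 1) / 2 := by
  have hinc := mul_le_increment_of_mem_curvatureClass h j
  obtain ⟨c', -, hw, -⟩ := h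
  have hd : 0 ≤ (1 - c) * w 1 := mul_nonneg (sub_nonneg.2 hc) (hw.2 1 le_rfl).le
  rw [averagedMarginal, Nat.add_sub_cancel, Real.coe_toNNReal]
  linarith

theorem sum_averagedMarginal_succ (hc : c ≤ 1) (h : w ∈ curvatureClass c) (x : ℕ) :
    ∑ j ∈ range x, (averagedMarginal c w (j + 1) : ℝ) = (w x + x * ((1 - c) * w 1)) / 2 := by
  simp only [coe_averagedMarginal_succ hc h]
  obtain ⟨c', -, hw, -⟩ := h
  rw [← sum_div, sum_add_distrib, sum_range_sub, sum_const, card_range, nsmul_eq_mul, hw.1,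
    sub_zero]

/-- Smoothness of a utility rule `f` for a welfare rule `w`: here `x` stands for the load of a
resource after a one-round walk and `y` for its load in a profile that the walk competes with. -/
def IsSmooth (α : ℝ) (w : ℕ → ℝ) (f : ℕ → ℝ≥0) : Prop :=
  ∀ x y : ℕ, α * w y + ∑ j ∈ range x, (f (j + 1) : ℝ) ≤ w x + y * f (x + 1)

theorem isSmooth_averagedMarginal (hc : c ≤ 1) (h : w ∈ curvatureClass c) :
    IsSmooth (1 - c / 2) w (averagedMarginal c w) := fun x y => by
  rw [sum_averagedMarginal_succ hc h, coe_averagedMarginal_succ hc h]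
  have hinc : (x : ℝ) * ((1 - c) * w 1) ≤ x * (w (x + 1) - w x) := by
    gcongr
    exact mul_le_increment_of_mem_curvatureClass h x
  obtain ⟨c', -, hw, hs, -⟩ := h
  have htangent := sub_le_mul_increment_of_antitone hs.antitone_increment
  have hlinear : (1 - c) * w y ≤ (1 - c) * (y * w 1) :=
    mul_le_mul_of_nonneg_left (by simpa [hw.1] using htangent 0 y) (sub_nonneg.2 hc)
  linarith [htangent x y]

end WelfareRule

theorem sum_card_filter_lt {ι M : Type*} [LinearOrder ι] [AddCommMonoid M] (s : Finset ι)
    (g : ℕ → M) : ∑ i ∈ s, g #{j ∈ s | j < i} = ∑ j ∈ range #s, g j := by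
  induction s using Finset.induction_on_max with
  | empty => simp
  | insert a s ha ih =>
    have hmax : {j ∈ insert a s | j < a} = s := by
      rw [filter_insert, if_neg (lt_irrefl a), filter_true_of_mem ha]
    have hrest : ∀ i ∈ s, {j ∈ insert a s | j < i} = {j ∈ s | j < i} := fun i hi => by
      rw [filter_insert, if_neg (ha i hi).not_gt]
    have has : a ∉ s := fun h => lt_irrefl a (ha a h)
    rw [sum_insert has, hmax, sum_congr rfl fun i hi => by rw [hrest i hi], ih,
      card_insert_of_notMem has, sum_range_succ, add_comm]

namespace Game

variable {G : Game}

section Profiles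

theorem welfare_eq_sum (h0 : ∀ r, G.w r 0 = 0) (a : G.Profile) :
    G.welfare a = ∑ r, G.w r (G.load a r) := by
  refine sum_subset (subset_univ _) fun r _ hr => ?_
  have hload : G.load a r = 0 := by simpa [load, filter_eq_empty_iff] using hr
  rw [hload, h0]

theorem finite_jointActions (G : Game) : G.jointActions.Finite :=
  (Fintype.piFinset G.act).finite_toSet.subset fun _ ha => mem_coe.2 (Fintype.mem_piFinset.2 ha)

theorem load_update_of_mem {a : G.Profile} {i : Fin G.n} (hi : a i = ∅) {e : Finset (Fin G.m)}
    {r : Fin G.m} (hr : r ∈ e) : G.load (update a i e) r = G.load a r + 1 := by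
  have hinsert : univ.filter (r ∈ update a i e ·) = insert i (univ.filter (r ∈ a ·)) := by
    ext j
    rcases eq_or_ne j i with rfl | hj <;> simp [*]
  rw [load, load, hinsert, card_insert_of_notMem (by simp [hi])]

theorem utility_update {a : G.Profile} {i : Fin G.n} (hi : a i = ∅) (e : Finset (Fin G.m)) :
    G.utility i (update a i e) = ∑ r ∈ e, (G.f r (G.load a r + 1) : ℝ) := by
  rw [utility, update_self]
  exact sum_congr rfl fun r hr => by rw [load_update_of_mem hi hr]

/-- The joint action in which the agents before `k` follow `b` and the others have not moved. -/
def truncate (b : G.Profile) (k : ℕ) : G.Profile := fun i => if (i : ℕ) < k then b i else ∅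

theorem truncate_self (b : G.Profile) (i : Fin G.n) : truncate b i i = ∅ :=
  if_neg (lt_irrefl _)

theorem load_truncate (b : G.Profile) (i : Fin G.n) (r : Fin G.m) :
    G.load (truncate b i) r = #{j ∈ {j | r ∈ b j} | j < i} := by
  rw [load, filter_filter]
  congr 1
  ext j
  by_cases hj : j < i <;> simp [truncate, hj]

theorem load_truncate_le (b : G.Profile) (i : Fin G.n) (r : Fin G.m) :
    G.load (truncate b i) r ≤ G.load b r := by
  rw [load_truncate]
  exact card_filter_le _ _

theorem sum_load_truncate {M : Type*} [AddCommMonoid M] (b : G.Profile) (g : Fin G.m → ℕ → M) :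
    ∑ i, ∑ r ∈ b i, g r (G.load (truncate b i) r) = ∑ r, ∑ j ∈ range (G.load b r), g r j :=
  calc ∑ i, ∑ r ∈ b i, g r (G.load (truncate b i) r)
      = ∑ r, ∑ i with r ∈ b i, g r (G.load (truncate b i) r) := sum_comm' (by simp)
    _ = ∑ r, ∑ j ∈ range (G.load b r), g r j := by
      simp only [load_truncate]
      exact sum_congr rfl fun r _ => sum_card_filter_lt _ (g r)

end Profiles

section Walks

theorem bestResponses_nonempty (G : Game) (a : G.Profile) (i : Fin G.n) :
    (G.bestResponses a i).Nonempty :=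
  exists_max_image (G.act i) (fun b => G.utility i (update a i b)) ⟨∅, G.null_mem i⟩

theorem exists_isTrajectory (hn : 0 < G.n) (T : ℕ) : ∃ a, G.IsTrajectory T a := by
  choose response hresponse using G.bestResponses_nonempty
  let mover (τ : ℕ) : Fin G.n := ⟨τ % G.n, Nat.mod_lt τ hn⟩
  let walk : ℕ → G.Profile :=
    Nat.rec (fun _ => ∅) fun τ a => update a (mover τ) (response a (mover τ))
  refine ⟨walk, rfl, fun τ _ => ⟨mover τ, rfl, ?_, fun j hj => update_of_ne hj _ _⟩⟩
  simpa only [walk, update_self] using hresponse (walk τ) (mover τ)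

theorem solutions_nonempty (G : Game) (k : ℕ) : (G.solutions k).Nonempty := by
  rcases Nat.eq_zero_or_pos G.n with hn | hn
  · exact ⟨_, fun _ _ => ∅, ⟨rfl, fun τ hτ => by simp [hn] at hτ⟩, rfl⟩
  · obtain ⟨a, ha⟩ := exists_isTrajectory hn (k * G.n)
    exact ⟨_, a, ha, rfl⟩

variable {T : ℕ} {a : ℕ → G.Profile}

theorem IsTrajectory.mem_jointActions (h : G.IsTrajectory T a) {τ : ℕ} (hτ : τ ≤ T) :
    a τ ∈ G.jointActions := by
  induction τ with
  | zero => exact fun i => by simpa only [h.1] using G.null_mem i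
  | succ τ ih =>
    obtain ⟨i, -, hbr, hkeep⟩ := h.2 τ hτ
    intro j
    rcases eq_or_ne j i with rfl | hj
    · exact hbr.1
    · rw [hkeep j hj]
      exact ih (by omega) j

theorem solutions_subset_jointActions (G : Game) (k : ℕ) : G.solutions k ⊆ G.jointActions := by
  rintro _ ⟨a, ha, rfl⟩
  exact ha.mem_jointActions le_rfl

theorem IsTrajectory.apply_eq_of_forall_mod_ne (h : G.IsTrajectory T a) {s t : ℕ} (hst : s ≤ t)
    (ht : t ≤ T) {j : Fin G.n} (hj : ∀ τ, s ≤ τ → τ < t → τ % G.n ≠ j) : a t j = a s j := by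
  induction t, hst using Nat.le_induction with
  | base => rfl
  | succ t hst ih =>
    obtain ⟨i, hi, -, hkeep⟩ := h.2 t ht
    rw [hkeep j fun hji => hj t hst t.lt_succ_self (hji ▸ hi.symm)]
    exact ih (by omega) fun τ hs hτ => hj τ hs (by omega)

theorem IsTrajectory.eq_truncate (h : G.IsTrajectory G.n a) {τ : ℕ} (hτ : τ ≤ G.n) :
    a τ = truncate (a G.n) τ := by
  have hmod : ∀ t < G.n, t % G.n = t := fun t => Nat.mod_eq_of_lt
  funext j
  rw [truncate]
  split_ifs with hj
  · exact (h.apply_eq_of_forall_mod_ne hτ le_rfl fun t hs ht => by rw [hmod t ht]; omega).symm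
  · rw [h.apply_eq_of_forall_mod_ne (Nat.zero_le τ) hτ fun t _ ht => by
      rw [hmod t (by omega)]; omega, h.1]

theorem isTrajectory_truncate {b : G.Profile}
    (h : ∀ i : Fin G.n, b i ∈ G.bestResponses (truncate b i) i) :
    G.IsTrajectory G.n (truncate b) := by
  refine ⟨by simp [funext_iff, truncate], fun τ hτ => ?_⟩
  refine ⟨⟨τ, hτ⟩, (Nat.mod_eq_of_lt hτ).symm, ?_, fun j hj => ?_⟩
  · simpa [truncate] using h ⟨τ, hτ⟩
  · have hlt : (j : ℕ) < τ + 1 ↔ (j : ℕ) < τ := by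
      have : (j : ℕ) ≠ τ := fun h => hj (Fin.ext h)
      omega
    simp only [truncate, hlt]

theorem mem_solutions_one_iff {b : G.Profile} :
    b ∈ G.solutions 1 ↔ ∀ i : Fin G.n, b i ∈ G.bestResponses (truncate b i) i := by
  simp only [solutions, one_mul]
  constructor
  · rintro ⟨a, ha, rfl⟩ i
    obtain ⟨i', hi', hbr, -⟩ := ha.2 i i.2
    obtain rfl : i' = i := Fin.ext (hi'.trans (Nat.mod_eq_of_lt i.2))
    have hlast : a (i' + 1) i' = a G.n i' := by
      rw [ha.eq_truncate i'.2]
      exact if_pos (Nat.lt_succ_self _)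
    rwa [← ha.eq_truncate i'.2.le, ← hlast]
  · intro h
    exact ⟨truncate b, isTrajectory_truncate h, by simp [funext_iff, truncate]⟩

theorem sum_utility_le_of_mem_solutions_one {b o : G.Profile} (hb : b ∈ G.solutions 1)
    (ho : o ∈ G.jointActions) :
    ∑ i, ∑ r ∈ o i, (G.f r (G.load (truncate b i) r + 1) : ℝ) ≤
      ∑ i, ∑ r ∈ b i, (G.f r (G.load (truncate b i) r + 1) : ℝ) := by
  refine sum_le_sum fun i _ => ?_
  rw [← utility_update (truncate_self b i), ← utility_update (truncate_self b i)]
  exact (mem_solutions_one_iff.1 hb i).2 _ (ho i)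

end Walks

section Efficiency

theorem sum_load_mul_le (hf : ∀ r, Antitone fun j => G.f r (j + 1)) (b o : G.Profile) :
    ∑ r, (G.load o r : ℝ) * G.f r (G.load b r + 1) ≤
      ∑ i, ∑ r ∈ o i, (G.f r (G.load (truncate b i) r + 1) : ℝ) :=
  calc ∑ r, (G.load o r : ℝ) * G.f r (G.load b r + 1)
      = ∑ r, ∑ i with r ∈ o i, (G.f r (G.load b r + 1) : ℝ) := by
        simp only [load, sum_const, nsmul_eq_mul]
    _ = ∑ i, ∑ r ∈ o i, (G.f r (G.load b r + 1) : ℝ) := sum_comm' (by simp)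
    _ ≤ ∑ i, ∑ r ∈ o i, (G.f r (G.load (truncate b i) r + 1) : ℝ) := by
        gcongr with i _ r _
        exact hf r (load_truncate_le b i r)

theorem mul_welfare_le_of_isSmooth {α : ℝ} (h0 : ∀ r, G.w r 0 = 0)
    (hf : ∀ r, Antitone fun j => G.f r (j + 1)) (hs : ∀ r, IsSmooth α (G.w r) (G.f r))
    {b o : G.Profile} (hb : b ∈ G.solutions 1) (ho : o ∈ G.jointActions) :
    α * G.welfare o ≤ G.welfare b := by
  have hsmooth := sum_le_sum fun r (_ : r ∈ univ) => hs r (G.load b r) (G.load o r)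
  rw [sum_add_distrib, sum_add_distrib, ← mul_sum, ← welfare_eq_sum h0, ← welfare_eq_sum h0]
    at hsmooth
  have hutility : ∑ r, (G.load o r : ℝ) * G.f r (G.load b r + 1) ≤
      ∑ r, ∑ j ∈ range (G.load b r), (G.f r (j + 1) : ℝ) :=
    calc _ ≤ _ := sum_load_mul_le hf b o
      _ ≤ _ := sum_utility_le_of_mem_solutions_one hb ho
      _ = _ := sum_load_truncate b fun r j => (G.f r (j + 1) : ℝ)
  linarith

theorem le_efficiency {α : ℝ} {k : ℕ} (hpos : ∃ a ∈ G.jointActions, 0 < G.welfare a)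
    (h : ∀ b ∈ G.solutions k, ∀ o ∈ G.jointActions, α * G.welfare o ≤ G.welfare b) :
    α ≤ G.efficiency k := by
  have hfin := G.finite_jointActions.image G.welfare
  obtain ⟨a, ha, hapos⟩ := hpos
  obtain ⟨o, ho, hmax⟩ := Set.Nonempty.csSup_mem (Set.Nonempty.image _ ⟨a, ha⟩) hfin
  have hopos : 0 < G.welfare o := by
    rw [hmax]
    exact hapos.trans_le (le_csSup hfin.bddAbove ⟨a, ha, rfl⟩)
  rw [efficiency, ← hmax, le_div_iff₀ hopos]
  refine le_csInf ((G.solutions_nonempty k).image _) ?_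
  rintro _ ⟨b, hb, rfl⟩
  exact h b hb o ho

theorem efficiency_le {k : ℕ} {b o : G.Profile} (hb : b ∈ G.solutions k) (ho : o ∈ G.jointActions)
    (hb0 : 0 ≤ G.welfare b) (hpos : 0 < G.welfare o) :
    G.efficiency k ≤ G.welfare b / G.welfare o := by
  have hfin := G.finite_jointActions.image G.welfare
  have hbdd := (hfin.subset (Set.image_mono (G.solutions_subset_jointActions k))).bddBelow
  exact div_le_div₀ hb0 (csInf_le hbdd ⟨b, hb, rfl⟩) hpos (le_csSup hfin.bddAbove ⟨o, ho, rfl⟩)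

end Efficiency

end Game

theorem le_setEfficiency_one_of_isSmooth {W : Set (ℕ → ℝ)} {F : UtilityDesign W} {α : ℝ}
    (h0 : ∀ w ∈ W, w 0 = 0) (hF : ∀ w : W, Antitone fun j => F w (j + 1))
    (hs : ∀ w : W, IsSmooth α w (F w)) : (α : EReal) ≤ setEfficiency (inducedGames W F) 1 := by
  refine le_iInf₂ fun G ⟨hG, hpos⟩ => EReal.coe_le_coe_iff.2 ?_
  choose hw hf using hG
  exact Game.le_efficiency hpos fun b hb o ho => Game.mul_welfare_le_of_isSmooth
    (fun r => h0 _ (hw r)) (fun r => hf r ▸ hF _) (fun r => hf r ▸ hs ⟨_, hw r⟩) hb ho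

theorem le_optimalEfficiency_one_curvatureClass {c : ℝ} (hc : c ≤ 1) :
    ((1 - c / 2 : ℝ) : EReal) ≤ optimalEfficiency (curvatureClass c) 1 := by
  refine le_iSup_of_le (fun w => averagedMarginal c w) (le_setEfficiency_one_of_isSmooth ?_ ?_ ?_)
  · rintro w ⟨c', -, hw, -⟩
    exact hw.1
  · rintro ⟨w, c', -, -, hs, -⟩
    exact antitone_averagedMarginal_succ hs.antitone_increment
  · exact fun w => isSmooth_averagedMarginal hc w.2

/-- The game in which the first agent chooses between two equal resources and the second agent may
only use the resource `0`. -/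
abbrev twoAgentGame (w : ℕ → ℝ) (f : ℕ → ℝ≥0) : Game where
  n := 2
  m := 2
  act := ![{∅, {0}, {1}}, {∅, {0}}]
  null_mem i := by fin_cases i <;> simp
  w _ := w
  f _ := f

section TwoAgentGame

variable {w : ℕ → ℝ} {f : ℕ → ℝ≥0}

theorem mem_solutions_twoAgentGame :
    (![{0}, {0}] : (twoAgentGame w f).Profile) ∈ (twoAgentGame w f).solutions 1 := by
  refine Game.mem_solutions_one_iff.2 fun i => ⟨by fin_cases i <;> simp, fun e he => ?_⟩
  simp only [Game.utility_update (Game.truncate_self _ _)]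
  fin_cases i
  · have hload (r) : (twoAgentGame w f).load (Game.truncate ![{0}, {0}] 0) r = 0 := by
      simp [Game.load, Game.truncate]
    have hact : e = ∅ ∨ e = {0} ∨ e = {1} := by simpa using he
    rcases hact with rfl | rfl | rfl <;> simp [hload]
  · have hact : e = ∅ ∨ e = {0} := by simpa using he
    rcases hact with rfl | rfl <;> simp

theorem mem_jointActions_twoAgentGame :
    (![{1}, {0}] : (twoAgentGame w f).Profile) ∈ (twoAgentGame w f).jointActions := by
  intro i
  fin_cases i <;> simp

theorem welfare_twoAgentGame_shared : (twoAgentGame w f).welfare ![{0}, {0}] = w 2 := by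
  have hunion : univ.biUnion (![{0}, {0}] : Fin 2 → Finset (Fin 2)) = {0} := by decide
  rw [Game.welfare, hunion, sum_singleton]
  rfl

theorem welfare_twoAgentGame_separate : (twoAgentGame w f).welfare ![{1}, {0}] = 2 * w 1 := by
  have hunion : univ.biUnion (![{1}, {0}] : Fin 2 → Finset (Fin 2)) = {1, 0} := by decide
  rw [Game.welfare, hunion, sum_pair one_ne_zero, two_mul]
  rfl

end TwoAgentGame

theorem optimalEfficiency_one_le {W : Set (ℕ → ℝ)} {w : ℕ → ℝ} (hW : w ∈ W)
    (hw : IsWelfareRule w) : optimalEfficiency W 1 ≤ ((w 2 / (2 * w 1) : ℝ) : EReal) := by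
  refine iSup_le fun F => ?_
  have hpos : 0 < (twoAgentGame w (F ⟨w, hW⟩)).welfare ![{1}, {0}] := by
    rw [welfare_twoAgentGame_separate]
    exact mul_pos two_pos (hw.2 1 le_rfl)
  have hle : (twoAgentGame w (F ⟨w, hW⟩)).efficiency 1 ≤ w 2 / (2 * w 1) := by
    rw [← welfare_twoAgentGame_shared (w := w) (f := F ⟨w, hW⟩),
      ← welfare_twoAgentGame_separate (w := w) (f := F ⟨w, hW⟩)]
    refine Game.efficiency_le mem_solutions_twoAgentGame mem_jointActions_twoAgentGame ?_ hpos
    rw [welfare_twoAgentGame_shared]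
    exact (hw.2 2 one_le_two).le
  exact iInf₂_le_of_le _ ⟨fun _ => ⟨hW, rfl⟩, _, mem_jointActions_twoAgentGame, hpos⟩
    (EReal.coe_le_coe_iff.2 hle)

/-- The welfare rule with first increment `1` and all later increments `1 - c`. It has the
smallest ratio `w 2 / w 1` among the welfare rules of curvature at most `c`. -/
def affineRule (c : ℝ) : ℕ → ℝ
  | 0 => 0
  | j + 1 => 1 + j * (1 - c)

theorem hasCurvature_affineRule {c : ℝ} (hc : c ∈ Set.Icc (0 : ℝ) 1) :
    HasCurvature (affineRule c) c := by
  have hone_sub : 0 ≤ 1 - c := sub_nonneg.2 hc.2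
  have hfirst : affineRule c 1 - affineRule c 0 = 1 := by simp [affineRule]
  have hlater : ∀ j, affineRule c (j + 2) - affineRule c (j + 1) = 1 - c := fun j => by
    simp only [affineRule]
    push_cast
    ring
  refine ⟨⟨rfl, fun j hj => ?_⟩, ⟨fun j => sub_nonneg.1 ?_, fun j => ?_⟩, hc, ?_⟩
  · obtain ⟨j, rfl⟩ := Nat.exists_eq_add_of_le' hj
    simp only [affineRule]
    positivity
  · cases j with
    | zero => simp only [hfirst, zero_add, zero_le_one]
    | succ j => rwa [hlater]
  · cases j with
    | zero => simp only [hfirst, hlater, zero_add]; linarith [hc.1]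
    | succ j => rw [hlater, hlater]
  · rw [← Filter.tendsto_add_atTop_iff_nat 1]
    have hconst : ∀ n, 1 - (affineRule c (n + 2) - affineRule c (n + 1)) / affineRule c 1 = c :=
      fun n => by rw [hlater, show affineRule c 1 = 1 by simp [affineRule]]; ring
    simp only [add_assoc, one_add_one_eq_two, hconst, tendsto_const_nhds]

theorem optimalEfficiency_one_curvatureClass_le {c : ℝ} (hc : c ∈ Set.Icc (0 : ℝ) 1) :
    optimalEfficiency (curvatureClass c) 1 ≤ ((1 - c / 2 : ℝ) : EReal) := by
  have hcurv := hasCurvature_affineRule hc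
  have hratio : affineRule c 2 / (2 * affineRule c 1) = 1 - c / 2 := by
    norm_num [affineRule]
    ring
  exact hratio ▸ optimalEfficiency_one_le ⟨c, le_rfl, hcurv⟩ hcurv.1

end ResourceAllocation

theorem theorem2 (c : ℝ) (hc : c ∈ Set.Icc (0 : ℝ) 1) :
    ResourceAllocation.optimalEfficiency (ResourceAllocation.curvatureClass c) 1
        = ((1 - c / 2 : ℝ) : EReal) ∧
      (1 / 2 : ℝ) ≤ 1 - c / 2 :=
  ⟨le_antisymm (ResourceAllocation.optimalEfficiency_one_curvatureClass_le hc)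
    (ResourceAllocation.le_optimalEfficiency_one_curvatureClass hc.2), by linarith [hc.2]⟩
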